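/- For $n\ge 1$ let $S_n=\{\boldsymbol x_0,\boldsymbol x_1,\dots,\boldsymbol x_{n+1}\}\subset\{0,\pm1\}^n$, where $\boldsymbol x_0=\boldsymbol 0$, $\boldsymbol x_i=-\boldsymbol e_{n-i+1}+\sum_{j=n-i+2}^{n}\boldsymbol e_j$ for $1\le i\le n$, and $\boldsymbol x_{n+1}=(1,\dots,1)^\top$. For an integer matrix $A=(a_{ij})$ put $|A|=\max|a_{ij}|$, and call an $n\times d$ matrix $A$ a sensing matrix for $\ell$-sparse vectors if $A\boldsymbol x\ne\boldsymbol 0$ for every nonzero $\boldsymbol x\in\mathbb R^d$ with at most $\ell$ nonzero coordinates. There is an $N$ such that for all integers $n\ge N$ and all $1\le\ell\le n-1$ there is an $n\times d$ integer matrix $A=A_{n,\ell}$, $d=d(n,\ell)$, with pairwise distinct columns, which is a sensing matrix for $\ell$-sparse vectors and satisfies $|A|=2$ and $$d\ \ge\ \left(\frac{n+2}{2}\right)^{1+\frac{2}{3\ell-2}}.$$ Moreover, these matrices can be chosen so that for every $\ell\ge2$ the following holds: there are a partition of the $n+2$ points of $S_n$ into two nonempty sets $I,J$ and a bipartite graph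 $\Gamma$ with vertex set $S_n$ and parts $I,J$, having no cycle of length $\le\ell$ (that is, of girth $>\ell$, where the girth of an acyclic graph is $\infty$), such that the columns of $A_{n,\ell}$ are exactly the differences $\boldsymbol x_i-\boldsymbol x_j$ with $\boldsymbol x_i\in I$, $\boldsymbol x_j\in J$ and $\{\boldsymbol x_i,\boldsymbol x_j\}$ an edge of $\Gamma$, one column for each edge. For this family, if $\varepsilon>0$ and $\ell=\ell(n)\geq 1$ is any sequence of integers with $\ell(n)\le(\log n)^{1-\varepsilon}$ for all large $n$, then $d(n,\ell(n))/n\to\infty$ as $n\to\infty$. -/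

import Mathlib

/-- An `n × d` real matrix is a sensing matrix for `ℓ`-sparse vectors if it kills no nonzero vector
with at most `ℓ` nonzero coordinates. -/
def IsSensingMatrix {n d : ℕ} (A : Matrix (Fin n) (Fin d) ℝ) (ℓ : ℕ) : Prop :=
  ∀ x : Fin d → ℝ, x ≠ 0 → {j | x j ≠ 0}.ncard ≤ ℓ → A.mulVec x ≠ 0

/-- The sup-norm `|A| = max |a_ij|` of an integer matrix. -/
def matrixSupNorm {n d : ℕ} (A : Matrix (Fin n) (Fin d) ℤ) : ℕ :=
  Finset.univ.sup fun p : Fin n × Fin d => (A p.1 p.2).natAbs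

/-- The points `x_0 = 0, x_1, …, x_n, x_{n+1} = (1, …, 1)` of the set `S_n ⊆ {0, ±1}^n`, where
`x_i = -e_{n-i+1} + ∑_{j=n-i+2}^n e_j` for `1 ≤ i ≤ n`. Coordinates are numbered from `0` here,
so `x_i` has `-1` at the position `j` with `j + i = n`, zeros before it and ones after it; the same
rule gives `0` for `i = 0` and the all-ones vector for `i = n + 1`. -/
def gridPoint (n : ℕ) (i : Fin (n + 2)) : Fin n → ℤ := fun j =>
  if (j : ℕ) + i < n then 0 else if (j : ℕ) + i = n then -1 else 1

/-- `A` is a matrix `A(D)`, where `D` is the family of differences `x_i - x_j` of points of `S_n`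
along the edges of the graph `Γ`, which is bipartite with parts `I` and `J` (`i ∈ I`, `j ∈ J`):
there is exactly one column for each edge. Vertices of `Γ` are the indices of the points. -/
def IsEdgeDifferenceMatrix {n d : ℕ} (A : Matrix (Fin n) (Fin d) ℤ)
    (Γ : SimpleGraph (Fin (n + 2))) (I J : Set (Fin (n + 2))) : Prop :=
  ∃ e : Fin d ≃ {p : Fin (n + 2) × Fin (n + 2) // p.1 ∈ I ∧ p.2 ∈ J ∧ Γ.Adj p.1 p.2},
    ∀ c : Fin d, A.col c = gridPoint n (e c).1.1 - gridPoint n (e c).1.2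

/-!
A relation of length at most `ℓ` among the differences `x_i - x_j` along the edges of a graph of
girth larger than `ℓ` is supported on a forest with at most `n` edges on `n + 2` vertices, so the
forest is disconnected. Regrouping the relation as a linear relation `∑ w_v x_v = 0` among the
points of `S_n`, the coefficients `w_v` sum to zero over every component. But the triangular shape
of `S_n` forces `w_1, …, w_{n+1}` to be positive multiples of a single number, so the sum over a
component avoiding `0` vanishes only if `w = 0`; in a forest this kills the original relation.

For the number of columns put `m = (n + 2) / 2`, `t = ℓ - 1` and `s = m ^ (1 / (3 t + 1))`, so that
`m s ^ 2` edges are wanted. If `s < 4 / 3`, a star has enough of them. Otherwise take an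
edge-maximal bipartite graph with balanced parts, girth larger than `ℓ` and degrees at most `r + 1`,
where `r = ⌊9 s ^ 2 / 8⌋`. Two vertices of degree at most `r` on opposite sides are at distance less
than `ℓ`, so on one side all but `O(r ^ t)` vertices have full degree `r + 1`; the factor `9 / 8`
pays for the exceptions. For `ℓ = 1` all nonzero vectors with entries in `{0, ±1, ±2}` serve as
columns.
-/

section ArcBoundary

variable {ι V R : Type*} [Fintype ι] [DecidableEq V] [Ring R]

/-- The boundary of a weighting `z` of the arcs `a c → b c`: the net weight leaving each vertex. -/
def arcBoundary (a b : ι → V) (z : ι → R) : V → R :=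
  ∑ c, z c • (Pi.single (a c) 1 - Pi.single (b c) 1)

lemma sum_arcBoundary_smul [Fintype V] {M : Type*} [AddCommGroup M] [Module R M]
    (a b : ι → V) (z : ι → R) (p : V → M) :
    ∑ v, arcBoundary a b z v • p v = ∑ c, z c • (p (a c) - p (b c)) := by
  simp only [← Fintype.linearCombination_apply R p, arcBoundary, map_sum, map_smul, map_sub,
    Fintype.linearCombination_apply_single, one_smul]

lemma sum_arcBoundary (a b : ι → V) (z : ι → R) (C : Finset V) :
    ∑ v ∈ C, arcBoundary a b z v =
      ∑ c, z c * ((if a c ∈ C then 1 else 0) - if b c ∈ C then 1 else 0) := by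
  simp only [arcBoundary, Finset.sum_apply, Pi.smul_apply, Pi.sub_apply, smul_eq_mul]
  rw [Finset.sum_comm]
  simp only [← Finset.mul_sum, Finset.sum_sub_distrib, Finset.sum_pi_single']

lemma sum_arcBoundary_eq_zero_of_forall_mem_iff {a b : ι → V} {z : ι → R} {C : Finset V}
    (hC : ∀ c, z c ≠ 0 → (a c ∈ C ↔ b c ∈ C)) : ∑ v ∈ C, arcBoundary a b z v = 0 := by
  rw [sum_arcBoundary]
  refine Finset.sum_eq_zero fun c _ => ?_
  by_cases hc : z c = 0
  · rw [hc, zero_mul]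
  · simp only [hC c hc, sub_self, mul_zero]

end ArcBoundary

section ActiveGraph

variable {ι V R : Type*} [Zero R]

/-- The graph formed by the arcs `a c → b c` of nonzero weight, without their orientation. -/
def activeGraph (a b : ι → V) (z : ι → R) : SimpleGraph V :=
  SimpleGraph.fromEdgeSet ((fun c => s(a c, b c)) '' {c | z c ≠ 0})

lemma activeGraph_adj {a b : ι → V} {z : ι → R} {c : ι} (hz : z c ≠ 0) (hab : a c ≠ b c) :
    (activeGraph a b z).Adj (a c) (b c) :=
  (SimpleGraph.fromEdgeSet_adj _).2 ⟨⟨c, hz, rfl⟩, hab⟩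

lemma activeGraph_le {Γ : SimpleGraph V} {a b : ι → V} (z : ι → R)
    (hΓ : ∀ c, Γ.Adj (a c) (b c)) : activeGraph a b z ≤ Γ := by
  rw [activeGraph, SimpleGraph.fromEdgeSet_le]
  rintro _ ⟨⟨c, -, rfl⟩, -⟩
  exact hΓ c

lemma ncard_edgeSet_activeGraph_le [Finite ι] (a b : ι → V) (z : ι → R) :
    (activeGraph a b z).edgeSet.ncard ≤ {c | z c ≠ 0}.ncard := by
  rw [activeGraph, SimpleGraph.edgeSet_fromEdgeSet]
  exact (Set.ncard_le_ncard Set.sdiff_subset).trans Set.ncard_image_le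

end ActiveGraph

lemma isAcyclic_of_ncard_edgeSet_lt_egirth {V : Type*} [Finite V] {H Γ : SimpleGraph V}
    (hle : H ≤ Γ) (hlt : (H.edgeSet.ncard : ℕ∞) < Γ.egirth) : H.IsAcyclic := by
  classical
  have := Fintype.ofFinite V
  intro v c hc
  have hcard : c.length ≤ H.edgeSet.ncard := by
    rw [← SimpleGraph.coe_edgeFinset, Set.ncard_coe_finset]
    exact hc.isTrail.length_le_card_edgeFinset
  have hgirth : Γ.egirth ≤ c.length :=
    (SimpleGraph.egirth_anti hle).trans (SimpleGraph.egirth_le_length hc)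
  exact (hlt.trans_le hgirth).not_ge (by exact_mod_cast hcard)

section Relations

variable {ι V R : Type*} [Fintype ι] [Ring R]

-- Every arc of a forest is a bridge, and the only weight crossing a bridge is that of the arc.
lemma eq_zero_of_arcBoundary_eq_zero [DecidableEq V] [Finite V] {a b : ι → V} {z : ι → R}
    (hab : ∀ c, a c ≠ b c) (hinj : Function.Injective fun c => s(a c, b c))
    (hac : (activeGraph a b z).IsAcyclic) (h0 : arcBoundary a b z = 0) : z = 0 := by
  classical
  have := Fintype.ofFinite V
  by_contra hne
  obtain ⟨c₀, hc₀⟩ := Function.ne_iff.1 hne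
  have hbridge : ¬ ((activeGraph a b z).deleteEdges {s(a c₀, b c₀)}).Reachable (a c₀) (b c₀) :=
    SimpleGraph.isBridge_iff.1
      (SimpleGraph.isAcyclic_iff_forall_adj_isBridge.1 hac (activeGraph_adj hc₀ (hab c₀)))
  set H := (activeGraph a b z).deleteEdges {s(a c₀, b c₀)}
  have hclosed (c) (hc : c ≠ c₀) (hz : z c ≠ 0) :
      H.Reachable (a c₀) (a c) ↔ H.Reachable (a c₀) (b c) := by
    have hadj : H.Adj (a c) (b c) :=
      (activeGraph a b z).deleteEdges_adj.2 ⟨activeGraph_adj hz (hab c), fun h => hc (hinj h)⟩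
    exact ⟨fun h => h.trans hadj.reachable, fun h => h.trans hadj.symm.reachable⟩
  have hcut := sum_arcBoundary a b z {v | H.Reachable (a c₀) v}
  rw [h0, Finset.sum_eq_single c₀ (fun c _ hc => ?_) (by simp)] at hcut
  · exact hc₀ (by simpa [hbridge] using hcut.symm)
  · by_cases hz : z c = 0
    · rw [hz, zero_mul]
    · simp only [Finset.mem_filter_univ, hclosed c hc hz, sub_self, mul_zero]

variable [Fintype V] {M : Type*} [AddCommGroup M] [Module R M]

/-- Points for which an affine dependency is trivial as soon as its coefficients sum to zero over
some nonempty proper subset of the points. Differences of such points along the edges of a graph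
admit no relation supported on a disconnected forest. -/
def IsSplitIndependent (R : Type*) {V M : Type*} [Fintype V] [Ring R] [AddCommGroup M] [Module R M]
    (p : V → M) : Prop :=
  ∀ w : V → R, ∑ v, w v • p v = 0 → ∑ v, w v = 0 →
    ∀ C : Finset V, C.Nonempty → C ≠ Finset.univ → ∑ v ∈ C, w v = 0 → w = 0

lemma IsSplitIndependent.arcBoundary_eq_zero [DecidableEq V] {p : V → M}
    (hp : IsSplitIndependent R p) {a b : ι → V} {z : ι → R} (hab : ∀ c, a c ≠ b c)
    (hrel : ∑ c, z c • (p (a c) - p (b c)) = 0) (hconn : ¬ (activeGraph a b z).Preconnected) :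
    arcBoundary a b z = 0 := by
  classical
  obtain ⟨u, v, huv⟩ : ∃ u v, ¬ (activeGraph a b z).Reachable u v := by
    simpa only [SimpleGraph.Preconnected, not_forall] using hconn
  refine hp _ (by rw [sum_arcBoundary_smul, hrel])
    (sum_arcBoundary_eq_zero_of_forall_mem_iff (by simp))
    {x | (activeGraph a b z).Reachable u x} ⟨u, by simp⟩
    (fun h => huv (by simpa using h.ge (Finset.mem_univ v)))
    (sum_arcBoundary_eq_zero_of_forall_mem_iff fun c hc => ?_)
  have hadj := activeGraph_adj hc (hab c)
  simp only [Finset.mem_filter_univ]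
  exact ⟨fun h => h.trans hadj.reachable, fun h => h.trans hadj.symm.reachable⟩

lemma IsSplitIndependent.eq_zero_of_sum_smul_sub_eq_zero {p : V → M}
    (hp : IsSplitIndependent R p) {Γ : SimpleGraph V} {a b : ι → V} {z : ι → R}
    (hΓ : ∀ c, Γ.Adj (a c) (b c)) (hinj : Function.Injective fun c => s(a c, b c))
    (hgirth : ({c | z c ≠ 0}.ncard : ℕ∞) < Γ.egirth)
    (hcard : {c | z c ≠ 0}.ncard + 1 < Fintype.card V)
    (hrel : ∑ c, z c • (p (a c) - p (b c)) = 0) : z = 0 := by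
  classical
  have hedges := ncard_edgeSet_activeGraph_le a b z
  have hab (c) : a c ≠ b c := (hΓ c).ne
  refine eq_zero_of_arcBoundary_eq_zero hab hinj
    (isAcyclic_of_ncard_edgeSet_lt_egirth (activeGraph_le z hΓ)
      (lt_of_le_of_lt (by exact_mod_cast hedges) hgirth))
    (hp.arcBoundary_eq_zero hab hrel fun hconn => ?_)
  have : Nonempty V := Fintype.card_pos_iff.1 (by omega)
  have hspan := (SimpleGraph.Connected.mk hconn).card_vert_le_card_edgeSet_add_one
  rw [Nat.card_coe_set_eq, Nat.card_eq_fintype_card] at hspan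
  omega

end Relations

section GridPoint

variable {n : ℕ} {R : Type*} [Ring R]

lemma sum_gridPoint_apply (w : Fin (n + 2) → R) {v : Fin (n + 2)} {j : Fin n}
    (hj : (j : ℕ) + v = n) :
    ∑ u, w u * gridPoint n u j = ∑ u ∈ Finset.Ioi v, w u - w v := by
  have hterm (u : Fin (n + 2)) : w u * gridPoint n u j =
      (if v < u then w u else 0) - if u = v then w u else 0 := by
    rcases lt_trichotomy u v with h | rfl | h
    · rw [gridPoint, if_pos (by omega), if_neg h.not_gt, if_neg h.ne]; simp
    · rw [gridPoint, if_neg (by omega), if_pos hj, if_neg (lt_irrefl u), if_pos rfl]; simp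
    · rw [gridPoint, if_neg (by omega), if_neg (by omega), if_pos h, if_neg h.ne']; simp
  simp only [hterm, Finset.sum_sub_distrib, Finset.sum_ite_eq', Finset.mem_univ, if_true,
    ← Finset.sum_filter, Finset.filter_lt_eq_Ioi]

variable [LinearOrder R] [IsStrictOrderedRing R]

-- The coordinate `n - v` of a linear relation says that the coefficient at `v` is the sum of the
-- later ones, so the coefficients double on the way down from the last point.
lemma exists_pos_eq_mul_last_of_sum_gridPoint_eq_zero {w : Fin (n + 2) → R}
    (hw : ∑ v, w v • (fun j => (gridPoint n v j : R)) = 0) (i : Fin (n + 1)) :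
    (∃ c > 0, w i.succ = c * w (Fin.last _)) ∧
      ∃ c > 0, ∑ v ∈ Finset.Ici i.succ, w v = c * w (Fin.last _) := by
  have hIci (v) : ∑ u ∈ Finset.Ici v, w u = w v + ∑ u ∈ Finset.Ioi v, w u := by
    rw [Finset.Ici_eq_cons_Ioi, Finset.sum_cons]
  induction i using Fin.reverseInduction with
  | last => exact ⟨⟨1, one_pos, by simp⟩, 1, one_pos, by simp [← Fin.top_eq_last]⟩
  | cast i ih =>
    obtain ⟨c, hc, htail⟩ := ih.2
    have hIoi : Finset.Ioi i.castSucc.succ = Finset.Ici i.succ.succ := by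
      ext v
      simp only [Finset.mem_Ioi, Finset.mem_Ici, Fin.lt_def, Fin.le_def, Fin.val_succ,
        Fin.val_castSucc, Nat.succ_le_iff]
    have hcoord : w i.castSucc.succ = ∑ v ∈ Finset.Ioi i.castSucc.succ, w v := by
      have hrow := congrFun hw i.rev
      simp only [Finset.sum_apply, Pi.smul_apply, smul_eq_mul, Pi.zero_apply] at hrow
      rw [sum_gridPoint_apply w (v := i.castSucc.succ) (by simp), sub_eq_zero] at hrow
      exact hrow.symm
    refine ⟨⟨c, hc, by rw [hcoord, hIoi, htail]⟩, c + c, by positivity, ?_⟩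
    rw [hIci, hcoord, hIoi, htail, add_mul]

lemma isSplitIndependent_gridPoint (n : ℕ) :
    IsSplitIndependent R fun v j => (gridPoint n v j : R) := by
  intro w hw hsum C hne huniv hC
  wlog h0 : 0 ∉ C generalizing C
  · refine this Cᶜ ?_ ?_ ?_ (by simpa using h0)
    · rwa [← Finset.compl_ne_univ_iff_nonempty, compl_compl]
    · rwa [Finset.compl_ne_univ_iff_nonempty]
    · rwa [← Finset.sum_add_sum_compl C, hC, zero_add] at hsum
  have hscale (v : Fin (n + 2)) (hv : v ≠ 0) : ∃ c > 0, w v = c * w (Fin.last _) := by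
    obtain ⟨i, rfl⟩ := Fin.exists_succ_eq.2 hv
    exact (exists_pos_eq_mul_last_of_sum_gridPoint_eq_zero hw i).1
  choose! c hc hwc using hscale
  have hC0 (v) (hv : v ∈ C) : v ≠ 0 := ne_of_mem_of_not_mem hv h0
  have hlast : w (Fin.last _) = 0 := by
    rw [Finset.sum_congr rfl fun v hv => hwc v (hC0 v hv), ← Finset.sum_mul] at hC
    exact (mul_eq_zero.1 hC).resolve_left (Finset.sum_pos (fun v hv => hc v (hC0 v hv)) hne).ne'
  have hpos (v) (hv : v ≠ 0) : w v = 0 := by rw [hwc v hv, hlast, mul_zero]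
  have hzero : w 0 = 0 := by
    rwa [Finset.sum_eq_single 0 (fun v _ hv => hpos v hv) (by simp)] at hsum
  ext v
  rcases eq_or_ne v 0 with rfl | hv
  exacts [hzero, hpos v hv]

lemma natAbs_gridPoint_sub_le (u v : Fin (n + 2)) (j : Fin n) :
    (gridPoint n u j - gridPoint n v j).natAbs ≤ 2 := by
  simp only [gridPoint]
  split_ifs <;> decide

lemma exists_natAbs_gridPoint_sub_eq_two {u v : Fin (n + 2)} (hu : u ≠ 0) (hv : v ≠ 0)
    (huv : u ≠ v) : ∃ j, (gridPoint n u j - gridPoint n v j).natAbs = 2 := by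
  wlog h : u < v generalizing u v
  · obtain ⟨j, hj⟩ := this hv hu huv.symm (huv.symm.lt_of_le (not_lt.1 h))
    exact ⟨j, by rwa [← Int.natAbs_neg, neg_sub]⟩
  have hu0 : (u : ℕ) ≠ 0 := Fin.val_ne_zero_iff.2 hu
  refine ⟨⟨n - u, by omega⟩, ?_⟩
  rw [gridPoint, gridPoint, if_neg (by simp; omega), if_pos (by simp; omega),
    if_neg (by simp; omega), if_neg (by simp; omega)]
  rfl

end GridPoint

section EdgeDifferenceMatrix

variable {n d ℓ : ℕ} {Γ : SimpleGraph (Fin (n + 2))} {I J : Set (Fin (n + 2))}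

lemma IsEdgeDifferenceMatrix.isSensingMatrix {A : Matrix (Fin n) (Fin d) ℤ}
    (hA : IsEdgeDifferenceMatrix A Γ I J) (hIJ : Disjoint I J) (hgirth : (ℓ : ℕ∞) < Γ.egirth)
    (hℓ : ℓ ≤ n) : IsSensingMatrix (A.map (Int.cast : ℤ → ℝ)) ℓ := by
  obtain ⟨e, he⟩ := hA
  intro z hz hsupp hker
  have hinj : Function.Injective fun c => s((e c).1.1, (e c).1.2) := by
    intro c c' h
    rcases Sym2.eq_iff.1 h with ⟨h₁, h₂⟩ | ⟨h₁, -⟩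
    · exact e.injective (Subtype.ext (Prod.ext h₁ h₂))
    · exact (hIJ.ne_of_mem (e c).2.1 (e c').2.2.1 h₁).elim
  have hrel : ∑ c, z c • ((fun j => (gridPoint n (e c).1.1 j : ℝ)) -
      fun j => (gridPoint n (e c).1.2 j : ℝ)) = 0 := by
    rw [← hker]
    ext j
    simp only [Matrix.mulVec_eq_sum, Finset.sum_apply, Pi.smul_apply, Pi.sub_apply,
      Matrix.transpose_apply, Matrix.map_apply, op_smul_eq_smul]
    refine Finset.sum_congr rfl fun c _ => ?_
    rw [← Matrix.col_apply A, he c, Pi.sub_apply, Int.cast_sub]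
  refine hz ((isSplitIndependent_gridPoint n).eq_zero_of_sum_smul_sub_eq_zero
    (fun c => (e c).2.2.2) hinj (lt_of_le_of_lt (by exact_mod_cast hsupp) hgirth) ?_ hrel)
  rw [Fintype.card_fin]
  omega

lemma IsSensingMatrix.injective_col {A : Matrix (Fin n) (Fin d) ℤ}
    (hA : IsSensingMatrix (A.map (Int.cast : ℤ → ℝ)) ℓ) (hℓ : 2 ≤ ℓ) :
    Function.Injective A.col := by
  intro c c' h
  by_contra hne
  refine hA (Pi.single c 1 - Pi.single c' 1) (fun h0 => ?_) ?_ ?_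
  · simpa [hne] using congrFun h0 c
  · have hsub : {j | (Pi.single c 1 - Pi.single c' 1 : Fin d → ℝ) j ≠ 0} ⊆ {c, c'} := by
      intro j hj
      by_contra! hj'
      simp only [Set.mem_insert_iff, Set.mem_singleton_iff, not_or] at hj'
      exact hj (by simp [hj'.1, hj'.2])
    exact (Set.ncard_le_ncard hsub).trans ((Set.ncard_pair hne).trans_le hℓ)
  · rw [Matrix.mulVec_sub, Matrix.mulVec_single_one, Matrix.mulVec_single_one, sub_eq_zero]
    ext j
    exact congrArg (Int.cast : ℤ → ℝ) (congrFun h j)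

lemma matrixSupNorm_eq_of_le_of_exists {A : Matrix (Fin n) (Fin d) ℤ} {k : ℕ}
    (hle : ∀ i j, (A i j).natAbs ≤ k) (hex : ∃ i j, (A i j).natAbs = k) :
    matrixSupNorm A = k := by
  obtain ⟨i, j, rfl⟩ := hex
  exact le_antisymm (Finset.sup_le fun p _ => hle p.1 p.2)
    (Finset.le_sup (f := fun p : Fin n × Fin d => (A p.1 p.2).natAbs) (Finset.mem_univ (i, j)))

lemma IsEdgeDifferenceMatrix.matrixSupNorm_eq_two {A : Matrix (Fin n) (Fin d) ℤ}
    (hA : IsEdgeDifferenceMatrix A Γ I J) (hΓ : Γ.IsBipartiteWith I J)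
    (hedge : ∃ u v, u ≠ 0 ∧ v ≠ 0 ∧ Γ.Adj u v) : matrixSupNorm A = 2 := by
  obtain ⟨e, he⟩ := hA
  have hentry (j : Fin n) (c : Fin d) :
      A j c = gridPoint n (e c).1.1 j - gridPoint n (e c).1.2 j := congrFun (he c) j
  refine matrixSupNorm_eq_of_le_of_exists
    (fun j c => hentry j c ▸ natAbs_gridPoint_sub_le _ _ j) ?_
  obtain ⟨u, v, hu, hv, huv⟩ := hedge
  wlog huvIJ : u ∈ I ∧ v ∈ J generalizing u v
  · exact this v u hv hu huv.symm ((hΓ.mem_of_adj huv).resolve_left huvIJ).symm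
  obtain ⟨j, hj⟩ := exists_natAbs_gridPoint_sub_eq_two hu hv huv.ne
  refine ⟨j, e.symm ⟨(u, v), huvIJ.1, huvIJ.2, huv⟩, ?_⟩
  rwa [hentry, Equiv.apply_symm_apply]

lemma card_orientedEdges {V : Type*} {Γ : SimpleGraph V} {I J : Set V}
    (hΓ : Γ.IsBipartiteWith I J) :
    Nat.card {p : V × V // p.1 ∈ I ∧ p.2 ∈ J ∧ Γ.Adj p.1 p.2} = Nat.card Γ.edgeSet := by
  refine Nat.card_eq_of_bijective (fun p => ⟨s(p.1.1, p.1.2), p.2.2.2⟩) ⟨?_, ?_⟩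
  · rintro ⟨⟨u, v⟩, hu, hv, h⟩ ⟨⟨u', v'⟩, hu', hv', h'⟩ heq
    rcases Sym2.eq_iff.1 (Subtype.ext_iff.1 heq) with ⟨h₁, h₂⟩ | ⟨h₁, -⟩
    · exact Subtype.ext (Prod.ext h₁ h₂)
    · exact (hΓ.disjoint.ne_of_mem hu hv' h₁).elim
  · rintro ⟨e, he⟩
    induction e with | _ u v =>
    rcases hΓ.mem_of_adj he with ⟨hu, hv⟩ | ⟨hu, hv⟩
    · exact ⟨⟨(u, v), hu, hv, he⟩, rfl⟩
    · exact ⟨⟨(v, u), hv, hu, SimpleGraph.Adj.symm he⟩, Subtype.ext Sym2.eq_swap⟩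

lemma exists_isEdgeDifferenceMatrix (hΓ : Γ.IsBipartiteWith I J) :
    ∃ A : Matrix (Fin n) (Fin (Nat.card Γ.edgeSet)) ℤ, IsEdgeDifferenceMatrix A Γ I J := by
  rw [← card_orientedEdges hΓ]
  let e := (Finite.equivFin {p : Fin (n + 2) × Fin (n + 2) //
    p.1 ∈ I ∧ p.2 ∈ J ∧ Γ.Adj p.1 p.2}).symm
  exact ⟨Matrix.of fun j c => gridPoint n (e c).1.1 j - gridPoint n (e c).1.2 j, e, fun _ => rfl⟩

end EdgeDifferenceMatrix

section Girth

variable {V : Type*} {Γ : SimpleGraph V} {u v : V}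

lemma exists_walk_length_lt_of_isCycle {x : V} {c : Γ.Walk x x} (hc : c.IsCycle)
    (huv : s(u, v) ∈ c.edges) : ∃ p : Γ.Walk u v, p.length < c.length ∧ s(u, v) ∉ p.edges := by
  classical
  have hu : u ∈ c.support := c.fst_mem_support_of_mem_edges huv
  wlog hx : x = u generalizing x
  · simpa only [SimpleGraph.Walk.length_rotate] using
      this (hc.rotate hu) ((c.rotate_edges u hu).mem_iff.2 huv) (by simp) rfl
  subst hx
  have hv : v ∈ c.support := c.snd_mem_support_of_mem_edges huv
  have hne : x ≠ v := (c.adj_of_mem_edges huv).ne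
  have hdisj : (c.takeUntil v hv).edges.Disjoint (c.dropUntil v hv).edges := by
    refine List.disjoint_of_nodup_append ?_
    rw [← SimpleGraph.Walk.edges_append, c.take_spec hv]
    exact hc.isTrail.edges_nodup
  by_cases htake : s(x, v) ∈ (c.takeUntil v hv).edges
  · refine ⟨(c.dropUntil v hv).reverse, ?_, ?_⟩
    · rw [SimpleGraph.Walk.length_reverse]
      exact SimpleGraph.Walk.length_dropUntil_lt_length hv hne.symm
    · rw [SimpleGraph.Walk.edges_reverse, List.mem_reverse]
      exact hdisj htake
  · exact ⟨_, SimpleGraph.Walk.length_takeUntil_lt_length hv hne.symm, htake⟩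

lemma min_egirth_edist_add_one_le_egirth_sup_edge :
    min Γ.egirth (Γ.edist u v + 1) ≤ (Γ ⊔ SimpleGraph.edge u v).egirth := by
  refine SimpleGraph.le_egirth.2 fun x c hc => ?_
  have hold {a b : V} (p : (Γ ⊔ SimpleGraph.edge u v).Walk a b) (hp : s(u, v) ∉ p.edges) :
      ∀ e ∈ p.edges, e ∈ Γ.edgeSet := by
    intro e he
    have hmem := p.edges_subset_edgeSet he
    rw [SimpleGraph.edgeSet_sup] at hmem
    exact hmem.resolve_right fun h => hp (SimpleGraph.edgeSet_edge_subset h ▸ he)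
  by_cases huv : s(u, v) ∈ c.edges
  · obtain ⟨p, hlen, hp⟩ := exists_walk_length_lt_of_isCycle hc huv
    have hdist := SimpleGraph.edist_le (p.transfer Γ (hold p hp))
    rw [SimpleGraph.Walk.length_transfer] at hdist
    calc min Γ.egirth (Γ.edist u v + 1) ≤ p.length + 1 :=
          (min_le_right _ _).trans (by gcongr)
      _ ≤ c.length := by exact_mod_cast hlen
  · have hgirth := SimpleGraph.egirth_le_length (hc.transfer (hold c huv))
    rw [SimpleGraph.Walk.length_transfer] at hgirth
    exact (min_le_left _ _).trans hgirth

end Girth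

section Ball

variable {V : Type*} {Γ : SimpleGraph V} {u : V} {r : ℕ}

lemma exists_adj_edist_eq {w : V} {k : ℕ} (h : Γ.edist w u = k + 1) :
    ∃ x, Γ.Adj w x ∧ Γ.edist x u = k := by
  obtain ⟨p, hp⟩ := SimpleGraph.exists_walk_of_edist_eq_coe (k := k + 1) (by exact_mod_cast h)
  cases p with
  | nil => simp at hp
  | @cons _ x _ hadj q =>
    refine ⟨x, hadj, le_antisymm ?_ ?_⟩
    · rw [SimpleGraph.Walk.length_cons, Nat.add_right_cancel_iff] at hp
      exact hp ▸ SimpleGraph.edist_le q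
    · have htriangle := SimpleGraph.edist_triangle (G := Γ) (u := w) (v := x) (w := u)
      rw [h, SimpleGraph.edist_eq_one_iff_adj.2 hadj, add_comm 1] at htriangle
      exact (ENat.add_le_add_iff_right ENat.one_ne_top).1 htriangle

variable [Finite V]

lemma ncard_neighborSet_diff_sphere_le (hdeg : ∀ v, (Γ.neighborSet v).ncard ≤ r + 1) {w : V}
    {k : ℕ} (hw : Γ.edist w u = k + 1) :
    (Γ.neighborSet w \ {x | Γ.edist x u = k}).ncard ≤ r := by
  obtain ⟨x, hx, hxk⟩ := exists_adj_edist_eq hw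
  have hlt : (Γ.neighborSet w \ {x | Γ.edist x u = k}).ncard < (Γ.neighborSet w).ncard :=
    Set.ncard_lt_ncard ⟨Set.sdiff_subset, fun h => (h hx).2 hxk⟩
  exact Nat.le_of_lt_succ (hlt.trans_le (hdeg w))

lemma ncard_sphere_le (hdeg : ∀ v, (Γ.neighborSet v).ncard ≤ r + 1)
    (hu : (Γ.neighborSet u).ncard ≤ r) : ∀ k : ℕ, {v | Γ.edist v u = k}.ncard ≤ r ^ k
  | 0 => by simp
  | 1 => by
    simp only [Nat.cast_one, SimpleGraph.edist_eq_one_iff_adj, SimpleGraph.adj_comm _ _ u, pow_one]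
    exact hu
  | k + 2 => by
    set S := (Set.toFinite {w | Γ.edist w u = (k + 1 : ℕ)}).toFinset with hS
    have hsub : {v | Γ.edist v u = (k + 2 : ℕ)} ⊆
        ⋃ w ∈ S, Γ.neighborSet w \ {x | Γ.edist x u = k} := by
      intro v (hv : Γ.edist v u = (k + 2 : ℕ))
      obtain ⟨w, hvw, hw⟩ := exists_adj_edist_eq (k := k + 1) hv
      refine Set.mem_biUnion (x := w) (by simpa [hS] using hw) ⟨hvw.symm, ?_⟩
      rw [Set.mem_ofPred_eq, hv, Nat.cast_inj]
      omega
    calc {v | Γ.edist v u = (k + 2 : ℕ)}.ncard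
        ≤ (⋃ w ∈ S, Γ.neighborSet w \ {x | Γ.edist x u = k}).ncard := Set.ncard_le_ncard hsub
      _ ≤ ∑ w ∈ S, (Γ.neighborSet w \ {x | Γ.edist x u = k}).ncard :=
          Finset.set_ncard_biUnion_le _ _
      _ ≤ S.card * r := Finset.sum_le_card_nsmul _ _ _ fun w hw =>
          ncard_neighborSet_diff_sphere_le hdeg (by simpa [hS] using hw)
      _ ≤ r ^ (k + 1) * r := by
          rw [hS, ← Set.ncard_eq_toFinset_card]
          exact Nat.mul_le_mul_right r (ncard_sphere_le hdeg hu (k + 1))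
      _ = r ^ (k + 2) := (pow_succ r (k + 1)).symm

lemma ncard_ball_le (hr : 2 ≤ r) (hdeg : ∀ v, (Γ.neighborSet v).ncard ≤ r + 1)
    (hu : (Γ.neighborSet u).ncard ≤ r) (k : ℕ) : (Γ.ball u (k + 1 : ℕ)).ncard ≤ 2 * r ^ k := by
  have hsub : Γ.ball u (k + 1 : ℕ) ⊆ ⋃ i ∈ Finset.range (k + 1), {v | Γ.edist v u = i} := by
    intro v hv
    obtain ⟨i, hi⟩ := ENat.ne_top_iff_exists.1 (ne_top_of_lt (SimpleGraph.mem_ball.1 hv))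
    rw [SimpleGraph.mem_ball, ← hi, Nat.cast_lt] at hv
    exact Set.mem_biUnion (x := i) (by simpa using hv) hi.symm
  calc (Γ.ball u (k + 1 : ℕ)).ncard
      ≤ ∑ i ∈ Finset.range (k + 1), {v | Γ.edist v u = i}.ncard :=
        (Set.ncard_le_ncard hsub).trans (Finset.set_ncard_biUnion_le _ _)
    _ ≤ ∑ i ∈ Finset.range (k + 1), r ^ i :=
        Finset.sum_le_sum fun i _ => ncard_sphere_le hdeg hu i
    _ ≤ 2 * r ^ k := by
        have hgeom := Nat.geomSum_lt hr (s := Finset.range k) fun _ => Finset.mem_range.1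
        rw [Finset.sum_range_succ]
        omega

end Ball

section Greedy

variable {V : Type*} {Γ : SimpleGraph V} {u v : V}

lemma isBipartiteWith_sup_edge {I J : Set V} (hΓ : Γ.IsBipartiteWith I J) (hu : u ∈ I)
    (hv : v ∈ J) : (Γ ⊔ SimpleGraph.edge u v).IsBipartiteWith I J := by
  refine ⟨hΓ.disjoint, fun x y hxy => ?_⟩
  rw [SimpleGraph.sup_adj, SimpleGraph.edge_adj] at hxy
  rcases hxy with h | ⟨⟨rfl, rfl⟩ | ⟨rfl, rfl⟩, -⟩
  exacts [hΓ.mem_of_adj h, Or.inl ⟨hu, hv⟩, Or.inr ⟨hv, hu⟩]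

variable [Finite V] {I J : Finset V} {g k : ℕ}

lemma sum_ncard_neighborSet_eq_card_edgeSet (hΓ : Γ.IsBipartiteWith I J) :
    ∑ v ∈ I, (Γ.neighborSet v).ncard = Nat.card Γ.edgeSet := by
  classical
  have := Fintype.ofFinite V
  rw [Nat.card_eq_fintype_card, ← SimpleGraph.edgeFinset_card,
    ← SimpleGraph.isBipartiteWith_sum_degrees_eq_card_edges hΓ]
  refine Finset.sum_congr rfl fun v _ => ?_
  rw [← SimpleGraph.card_neighborSet_eq_degree, Set.ncard_eq_toFinset_card', Set.toFinset_card]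

lemma mul_card_le_card_edgeSet (hΓ : Γ.IsBipartiteWith I J) {S : Finset V} (hS : S ⊆ I)
    (hdeg : ∀ v ∈ S, k ≤ (Γ.neighborSet v).ncard) : k * S.card ≤ Nat.card Γ.edgeSet := by
  rw [← sum_ncard_neighborSet_eq_card_edgeSet hΓ, mul_comm]
  exact (Finset.card_nsmul_le_sum _ _ _ hdeg).trans (Finset.sum_le_sum_of_subset hS)

/-- The bipartite graphs with parts `I` and `J`, girth larger than `g` and all degrees at most `k`,
among which the greedy construction looks for one with many edges. -/
def girthDegreeGraphs (I J : Finset V) (g k : ℕ) : Set (SimpleGraph V) :=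
  {Γ | Γ.IsBipartiteWith I J ∧ (g : ℕ∞) < Γ.egirth ∧ ∀ v, (Γ.neighborSet v).ncard ≤ k}

lemma exists_maximal_girthDegreeGraphs (hIJ : Disjoint I J) (g k : ℕ) :
    ∃ Γ, Maximal (· ∈ girthDegreeGraphs I J g k) Γ := by
  refine (Set.toFinite _).exists_maximal ⟨⊥, ⟨by exact_mod_cast hIJ, fun _ _ h => h.elim⟩, ?_, ?_⟩
  · rw [SimpleGraph.egirth_bot]
    exact ENat.natCast_lt_top _
  · simp [SimpleGraph.neighborSet]

lemma ncard_neighborSet_sup_edge_le (hdeg : ∀ w, (Γ.neighborSet w).ncard ≤ k)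
    (hu : (Γ.neighborSet u).ncard < k) (hv : (Γ.neighborSet v).ncard < k) (w : V) :
    ((Γ ⊔ SimpleGraph.edge u v).neighborSet w).ncard ≤ k := by
  have hsup : (Γ ⊔ SimpleGraph.edge u v).neighborSet w =
      Γ.neighborSet w ∪ (SimpleGraph.edge u v).neighborSet w := by ext; simp
  rw [hsup]
  refine (Set.ncard_union_le _ _).trans ?_
  by_cases hw : w = u ∨ w = v
  · have hone : ((SimpleGraph.edge u v).neighborSet w).ncard ≤ 1 := by
      refine (Set.ncard_le_one_iff (Set.toFinite _)).2 fun ha hb => ?_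
      simp only [SimpleGraph.mem_neighborSet, SimpleGraph.edge_adj] at ha hb
      grind
    have hlt : (Γ.neighborSet w).ncard < k := by
      rcases hw with rfl | rfl
      exacts [hu, hv]
    omega
  · have hempty : (SimpleGraph.edge u v).neighborSet w = ∅ := by
      ext x
      simp only [SimpleGraph.mem_neighborSet, SimpleGraph.edge_adj, Set.mem_empty_iff_false]
      grind
    rw [hempty, Set.ncard_empty]
    exact hdeg w

lemma edist_lt_of_maximal_girthDegreeGraphs (hΓ : Maximal (· ∈ girthDegreeGraphs I J g k) Γ)
    (hg : 2 ≤ g) (hu : u ∈ I) (hv : v ∈ J) (hdu : (Γ.neighborSet u).ncard < k)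
    (hdv : (Γ.neighborSet v).ncard < k) : Γ.edist u v < g := by
  obtain ⟨hbip, hgirth, hdeg⟩ := hΓ.prop
  by_contra! hfar
  have hgirth' : (g : ℕ∞) < (Γ ⊔ SimpleGraph.edge u v).egirth :=
    (lt_min hgirth (ENat.natCast_lt_add_one_iff.2 hfar)).trans_le
      min_egirth_edist_add_one_le_egirth_sup_edge
  have hmem : Γ ⊔ SimpleGraph.edge u v ∈ girthDegreeGraphs I J g k :=
    ⟨isBipartiteWith_sup_edge hbip hu hv, hgirth', ncard_neighborSet_sup_edge_le hdeg hdu hdv⟩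
  have hadj : Γ.Adj u v := by
    by_contra hadj
    exact hΓ.not_gt hmem (Γ.lt_sup_edge _ _ (hbip.disjoint.ne_of_mem hu hv) hadj)
  rw [SimpleGraph.edist_eq_one_iff_adj.2 hadj] at hfar
  exact absurd (hg.trans (by exact_mod_cast hfar)) (by norm_num)

lemma mul_card_le_card_edgeSet_add_of_maximal {r t c : ℕ}
    (hΓ : Maximal (· ∈ girthDegreeGraphs I J (t + 1) (r + 1)) Γ) (hr : 2 ≤ r) (ht : 1 ≤ t)
    (hI : c ≤ I.card) (hJ : c ≤ J.card) :
    (r + 1) * c ≤ Nat.card Γ.edgeSet + (r + 1) * (2 * r ^ t) := by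
  classical
  obtain ⟨hbip, -, hdeg⟩ := hΓ.prop
  by_cases hfull : ∀ u ∈ I, r + 1 ≤ (Γ.neighborSet u).ncard
  · calc (r + 1) * c ≤ (r + 1) * I.card := by gcongr
      _ ≤ Nat.card Γ.edgeSet := mul_card_le_card_edgeSet hbip subset_rfl hfull
      _ ≤ _ := Nat.le_add_right _ _
  push Not at hfull
  -- Every vertex of `J` of degree at most `r` lies in a small ball around `u`, which has degree at
  -- most `r` itself.
  obtain ⟨u, huI, hu⟩ := hfull
  set B := (Set.toFinite (Γ.ball u (t + 1 : ℕ))).toFinset with hBdef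
  have hB : B.card ≤ 2 * r ^ t := by
    rw [hBdef, ← Set.ncard_eq_toFinset_card]
    exact ncard_ball_le hr hdeg (Nat.le_of_lt_succ hu) t
  have hfar : (r + 1) * (J \ B).card ≤ Nat.card Γ.edgeSet := by
    refine mul_card_le_card_edgeSet hbip.symm Finset.sdiff_subset fun v hv => ?_
    obtain ⟨hvJ, hvB⟩ := Finset.mem_sdiff.1 hv
    by_contra! hlt
    refine hvB ((Set.Finite.mem_toFinset _).2 (SimpleGraph.mem_ball_comm.1 ?_))
    exact edist_lt_of_maximal_girthDegreeGraphs hΓ (by omega) huI hvJ hu hlt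
  calc (r + 1) * c ≤ (r + 1) * ((J \ B).card + B.card) := by
        gcongr
        exact hJ.trans Finset.card_le_card_sdiff_add_card
    _ ≤ Nat.card Γ.edgeSet + (r + 1) * (2 * r ^ t) := by
        rw [mul_add]
        gcongr

end Greedy

lemma exists_adj_ne_of_ncard_neighborSet_lt {V : Type*} [Finite V] {Γ : SimpleGraph V} {o : V}
    (h : (Γ.neighborSet o).ncard < Nat.card Γ.edgeSet) : ∃ u v, u ≠ o ∧ v ≠ o ∧ Γ.Adj u v := by
  by_contra! hno
  have hsub : Γ.edgeSet ⊆ (fun v => s(o, v)) '' Γ.neighborSet o := by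
    intro e he
    induction e with | _ u v =>
    by_cases hu : u = o
    · exact ⟨v, hu ▸ he, by rw [hu]⟩
    by_cases hv : v = o
    · exact ⟨u, hv ▸ SimpleGraph.Adj.symm he, by rw [hv, Sym2.eq_swap]⟩
    exact (hno u v hu hv he).elim
  exact h.not_ge ((Set.ncard_le_ncard hsub).trans Set.ncard_image_le)

/-- The graphs on the points of `S_n` that yield the matrices of the theorem: bipartite with
nonempty parts `I` and `J` covering all points, of girth larger than `ℓ`, and with an edge avoiding
the origin, which forces an entry of absolute value `2` in the matrix. -/
structure IsSensingGraph {n : ℕ} (ℓ : ℕ) (Γ : SimpleGraph (Fin (n + 2)))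
    (I J : Set (Fin (n + 2))) : Prop where
  nonempty_left : I.Nonempty
  nonempty_right : J.Nonempty
  union_eq_univ : I ∪ J = Set.univ
  isBipartiteWith : Γ.IsBipartiteWith I J
  lt_egirth : (ℓ : ℕ∞) < Γ.egirth
  exists_adj_ne_zero : ∃ u v, u ≠ 0 ∧ v ≠ 0 ∧ Γ.Adj u v

lemma isBipartiteWith_starGraph {V : Type*} (c : V) :
    (SimpleGraph.starGraph c).IsBipartiteWith {c} {c}ᶜ := by
  refine ⟨disjoint_compl_right, fun u v huv => ?_⟩
  rw [SimpleGraph.starGraph_adj] at huv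
  rcases huv with ⟨hne, rfl | rfl⟩
  exacts [Or.inl ⟨rfl, hne.symm⟩, Or.inr ⟨hne, rfl⟩]

lemma card_edgeSet_starGraph_add_one {V : Type*} [Fintype V] (c : V) :
    Nat.card (SimpleGraph.starGraph c).edgeSet + 1 = Fintype.card V := by
  classical
  rw [Nat.card_eq_fintype_card, ← SimpleGraph.edgeFinset_card]
  exact (SimpleGraph.isTree_starGraph c).card_edgeFinset

lemma isSensingGraph_starGraph {n : ℕ} (hn : 1 ≤ n) (ℓ : ℕ) :
    IsSensingGraph ℓ (SimpleGraph.starGraph (1 : Fin (n + 2))) {1} {1}ᶜ where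
  nonempty_left := ⟨1, rfl⟩
  nonempty_right := ⟨0, by simp⟩
  union_eq_univ := Set.union_compl_self _
  isBipartiteWith := isBipartiteWith_starGraph 1
  lt_egirth := by
    rw [(SimpleGraph.isAcyclic_starGraph _).egirth_eq_top]
    exact ENat.natCast_lt_top ℓ
  exists_adj_ne_zero := by
    have hne : (1 : Fin (n + 2)) ≠ Fin.last (n + 1) := by
      rw [Ne, Fin.ext_iff, Fin.val_one, Fin.val_last]
      omega
    exact ⟨1, Fin.last _, by simp, Fin.last_pos.ne', SimpleGraph.starGraph_center_adj hne⟩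

lemma exists_card_div_two_le_card (V : Type*) [Fintype V] [DecidableEq V] :
    ∃ I : Finset V, Fintype.card V / 2 ≤ I.card ∧ Fintype.card V / 2 ≤ Iᶜ.card := by
  obtain ⟨I, -, hI⟩ := Finset.exists_subset_card_eq (s := (Finset.univ : Finset V))
    (Nat.div_le_self _ 2)
  rw [Finset.card_univ] at hI
  refine ⟨I, hI.ge, ?_⟩
  rw [Finset.card_compl]
  omega

-- `(8 s / 9) ^ 2` dominates `s`, so the sixth power of the right-hand side dominates
-- `s ^ (3 * (t + 1))`.
lemma thirty_le_pow {s : ℝ} {t : ℕ} (hs : 4 / 3 ≤ s) (hlarge : 30 ^ 6 ≤ s ^ (3 * t + 1)) :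
    30 ≤ (8 / 9 * s) ^ (t + 1) := by
  refine le_of_pow_le_pow_left₀ (n := 6) (by norm_num) (by positivity) ?_
  calc (30 : ℝ) ^ 6 ≤ s ^ (3 * t + 1) := hlarge
    _ ≤ s ^ (3 * (t + 1)) := pow_le_pow_right₀ (by linarith) (by omega)
    _ ≤ ((8 / 9 * s) ^ 2) ^ (3 * (t + 1)) := by
        gcongr
        nlinarith
    _ = ((8 / 9 * s) ^ (t + 1)) ^ 6 := by
        rw [← pow_mul, ← pow_mul]
        congr 1
        ring

lemma thirty_mul_pow_le {r s : ℝ} {t : ℕ} (hs : 4 / 3 ≤ s) (hlarge : 30 ^ 6 ≤ s ^ (3 * t + 1))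
    (hr0 : 0 ≤ r) (hr : r ≤ 9 / 8 * s ^ 2) : 30 * r ^ (t + 1) ≤ s ^ (3 * t + 1) * s ^ 2 :=
  calc 30 * r ^ (t + 1) ≤ (8 / 9 * s) ^ (t + 1) * (9 / 8 * s ^ 2) ^ (t + 1) := by
        gcongr
        exact thirty_le_pow hs hlarge
    _ = s ^ (3 * t + 1) * s ^ 2 := by
        rw [← mul_pow, show 8 / 9 * s * (9 / 8 * s ^ 2) = s ^ 3 by ring]
        ring

lemma mul_sq_add_le_mul {m r s : ℝ} {t : ℕ} (hs : 4 / 3 ≤ s) (hm : s ^ (3 * t + 1) = m)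
    (hlarge : 30 ^ 6 ≤ m) (hr2 : 2 ≤ r) (hr : r ≤ 9 / 8 * s ^ 2) (hr1 : 9 / 8 * s ^ 2 ≤ r + 1) :
    m * s ^ 2 + (r + 1) * (2 * r ^ t) ≤ (r + 1) * (m - 1 / 2) := by
  have hloss : (r + 1) * (2 * r ^ t + 1 / 2) ≤ 30 * r ^ (t + 1) / 8 :=
    calc (r + 1) * (2 * r ^ t + 1 / 2) ≤ (3 / 2 * r) * (2 * r ^ t + 1 / 2 * r ^ t) := by
          gcongr
          · linarith
          · exact le_mul_of_one_le_right (by norm_num) (one_le_pow₀ (by linarith))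
      _ = 30 * r ^ (t + 1) / 8 := by ring
  have hsmall := thirty_mul_pow_le hs (hm ▸ hlarge) (by linarith) hr
  rw [hm] at hsmall
  have hgain : 9 / 8 * s ^ 2 * m ≤ (r + 1) * m := by gcongr
  linarith

lemma exists_isSensingGraph_greedy {n t : ℕ} {s : ℝ} (ht : 1 ≤ t) (hs : 4 / 3 ≤ s)
    (hsm : s ^ (3 * t + 1) = ((n : ℝ) + 2) / 2) (hn : 2 * 30 ^ 6 ≤ n) :
    ∃ (Γ : SimpleGraph (Fin (n + 2))) (I J : Set (Fin (n + 2))), IsSensingGraph (t + 1) Γ I J ∧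
      ((n : ℝ) + 2) / 2 * s ^ 2 ≤ Nat.card Γ.edgeSet := by
  obtain ⟨I, hI, hJ⟩ := exists_card_div_two_le_card (Fin (n + 2))
  rw [Fintype.card_fin] at hI hJ
  set r : ℕ := ⌊9 / 8 * s ^ 2⌋₊
  have hs2 : 16 / 9 ≤ s ^ 2 := by nlinarith
  have hr2 : 2 ≤ r := Nat.le_floor (by push_cast; linarith)
  have hr : (r : ℝ) ≤ 9 / 8 * s ^ 2 := Nat.floor_le (by positivity)
  have hn' : (2 * 30 ^ 6 : ℝ) ≤ n := by exact_mod_cast hn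
  obtain ⟨Γ, hΓ⟩ := exists_maximal_girthDegreeGraphs (disjoint_compl_right (a := I)) (t + 1) (r + 1)
  obtain ⟨hbip, hgirth, hdeg⟩ := hΓ.prop
  have hcard : ((n : ℝ) + 2) / 2 * s ^ 2 ≤ Nat.card Γ.edgeSet := by
    have hnum := mul_sq_add_le_mul hs hsm (by linarith) (by exact_mod_cast hr2) hr
      (Nat.lt_floor_add_one _).le
    have hhalf : ((n : ℝ) + 2) / 2 - 1 / 2 ≤ ((n + 2) / 2 : ℕ) := by
      have : ((n + 1 : ℕ) : ℝ) ≤ (2 * ((n + 2) / 2) : ℕ) := by gcongr; omega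
      push_cast at this ⊢
      linarith
    have hgreedy : ((r : ℝ) + 1) * ((n + 2) / 2 : ℕ) ≤
        Nat.card Γ.edgeSet + (r + 1) * (2 * r ^ t) := by
      exact_mod_cast mul_card_le_card_edgeSet_add_of_maximal hΓ hr2 ht hI hJ
    have := mul_le_mul_of_nonneg_left hhalf (by positivity : (0 : ℝ) ≤ r + 1)
    linarith
  have hdeg0 : (Γ.neighborSet 0).ncard < Nat.card Γ.edgeSet := by
    refine (hdeg 0).trans_lt (Nat.cast_lt (α := ℝ).1 (lt_of_lt_of_le ?_ hcard))
    push_cast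
    nlinarith
  refine ⟨Γ, I, ↑Iᶜ, ⟨?_, ?_, ?_, hbip, hgirth, exists_adj_ne_of_ncard_neighborSet_lt hdeg0⟩, hcard⟩
  · exact Finset.coe_nonempty.2 (Finset.card_pos.1 (by omega))
  · exact Finset.coe_nonempty.2 (Finset.card_pos.1 (by omega))
  · rw [Finset.coe_compl, Set.union_compl_self]

lemma rpow_one_add_two_div {m t : ℝ} (hm : 0 < m) (ht : 0 ≤ t) :
    m ^ (1 + 2 / (3 * (t + 1) - 2)) = m * (m ^ (3 * t + 1)⁻¹) ^ 2 := by
  rw [Real.rpow_one_add' hm.le (by ring_nf; positivity), ← Real.rpow_mul_natCast hm.le]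
  congr 2
  push_cast
  rw [show 3 * (t + 1) - 2 = 3 * t + 1 by ring]
  ring

lemma exists_isSensingGraph {n ℓ : ℕ} (hn : 2 * 30 ^ 6 ≤ n) (hℓ : 2 ≤ ℓ) :
    ∃ (Γ : SimpleGraph (Fin (n + 2))) (I J : Set (Fin (n + 2))), IsSensingGraph ℓ Γ I J ∧
      (((n : ℝ) + 2) / 2) ^ (1 + 2 / (3 * (ℓ : ℝ) - 2)) ≤ Nat.card Γ.edgeSet := by
  obtain ⟨t, rfl⟩ : ∃ t, ℓ = t + 1 := ⟨ℓ - 1, by omega⟩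
  rw [Nat.cast_succ, rpow_one_add_two_div (by positivity) t.cast_nonneg]
  set s : ℝ := (((n : ℝ) + 2) / 2) ^ (3 * (t : ℝ) + 1)⁻¹
  have hsm : s ^ (3 * t + 1) = ((n : ℝ) + 2) / 2 := by
    have hroot := Real.rpow_inv_natCast_pow (x := ((n : ℝ) + 2) / 2) (by positivity)
      (Nat.succ_ne_zero (3 * t))
    push_cast at hroot
    exact hroot
  rcases le_or_gt (4 / 3) s with hs | hs
  · exact exists_isSensingGraph_greedy (by omega) hs hsm hn
  · refine ⟨_, _, _, isSensingGraph_starGraph (by omega) (t + 1), ?_⟩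
    have hcard : (Nat.card (SimpleGraph.starGraph (1 : Fin (n + 2))).edgeSet : ℝ) + 1 = n + 2 := by
      exact_mod_cast (card_edgeSet_starGraph_add_one _).trans (Fintype.card_fin _)
    have hs0 : 0 ≤ s := by positivity
    have hs2 : s ^ 2 ≤ 16 / 9 := by nlinarith
    have hn' : (2 * 30 ^ 6 : ℝ) ≤ n := by exact_mod_cast hn
    nlinarith

lemma isSensingMatrix_one {n d : ℕ} {A : Matrix (Fin n) (Fin d) ℝ} (hA : ∀ c, A.col c ≠ 0) :
    IsSensingMatrix A 1 := by
  intro x hx hcard hker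
  obtain ⟨c, hc⟩ := Function.ne_iff.1 hx
  have hsingle : x = Pi.single c (x c) := by
    ext j
    by_cases hj : x j = 0
    · rw [hj, Pi.single_eq_of_ne]
      rintro rfl
      exact hc hj
    · rw [(Set.ncard_le_one_iff (Set.toFinite _)).1 hcard hj hc, Pi.single_eq_same]
  rw [hsingle, Matrix.mulVec_single, op_smul_eq_smul, smul_eq_zero] at hker
  exact hker.elim hc (hA c)

lemma exists_injective_col_range_col_eq {n : ℕ} (F : Finset (Fin n → ℤ)) :
    ∃ A : Matrix (Fin n) (Fin F.card) ℤ, Function.Injective A.col ∧ Set.range A.col = F := by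
  refine ⟨(Matrix.of fun c => (F.equivFin.symm c).1).transpose, ?_, ?_⟩
  · exact Subtype.val_injective.comp F.equivFin.symm.injective
  · exact (F.equivFin.symm.surjective.range_comp Subtype.val).trans Subtype.range_coe

lemma pow_three_lt_five_pow {n : ℕ} (hn : 2 ≤ n) : n ^ 3 < 5 ^ n := by
  induction n, hn using Nat.le_induction with
  | base => norm_num
  | succ n hn ih =>
    calc (n + 1) ^ 3 ≤ n ^ 3 * 5 := by nlinarith [mul_le_mul hn hn zero_le_two n.zero_le]
      _ < 5 ^ n * 5 := by gcongr
      _ = 5 ^ (n + 1) := (pow_succ 5 n).symm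

lemma exists_isSensingMatrix_one {n : ℕ} (hn : 2 ≤ n) :
    ∃ (d : ℕ) (A : Matrix (Fin n) (Fin d) ℤ), IsSensingMatrix (A.map (Int.cast : ℤ → ℝ)) 1 ∧
      matrixSupNorm A = 2 ∧ Function.Injective A.col ∧ n ^ 3 ≤ d := by
  set F : Finset (Fin n → ℤ) := (Fintype.piFinset fun _ => Finset.Icc (-2 : ℤ) 2).erase 0 with hF
  have hcard : F.card = 5 ^ n - 1 := by
    rw [hF, Finset.card_erase_of_mem (by simp [Fintype.mem_piFinset])]
    simp
  have hmem (v) : v ∈ F ↔ v ≠ 0 ∧ ∀ i, -2 ≤ v i ∧ v i ≤ 2 := by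
    rw [hF, Finset.mem_erase, Fintype.mem_piFinset]
    simp only [Finset.mem_Icc]
  obtain ⟨A, hinj, hrange⟩ := exists_injective_col_range_col_eq F
  have hcol (c) : A.col c ∈ F := by
    rw [← Finset.mem_coe, ← hrange]
    exact Set.mem_range_self c
  let i₀ : Fin n := ⟨0, by omega⟩
  obtain ⟨c₂, hc₂⟩ : (fun _ => 2) ∈ Set.range A.col := by
    rw [hrange, Finset.mem_coe, hmem]
    exact ⟨fun h => two_ne_zero (congrFun h i₀), fun _ => by norm_num⟩
  refine ⟨_, A, isSensingMatrix_one fun c hc => ((hmem _).1 (hcol c)).1 ?_,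
    matrixSupNorm_eq_of_le_of_exists (fun i c => ?_) ⟨i₀, c₂, ?_⟩, hinj, ?_⟩
  · ext i
    exact Int.cast_eq_zero.1 (congrFun hc i)
  · have hbound := ((hmem _).1 (hcol c)).2 i
    rw [Matrix.col_apply] at hbound
    omega
  · exact congrArg Int.natAbs (congrFun hc₂ i₀)
  · have hpow := pow_three_lt_five_pow hn
    omega

/-- The properties that the theorem asks of the matrix `A = A_{n,ℓ}`. -/
def IsLargeSensingMatrix {n d : ℕ} (ℓ : ℕ) (A : Matrix (Fin n) (Fin d) ℤ) : Prop :=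
  IsSensingMatrix (A.map (Int.cast : ℤ → ℝ)) ℓ ∧ matrixSupNorm A = 2 ∧ Function.Injective A.col ∧
  (((n : ℝ) + 2) / 2) ^ (1 + 2 / (3 * (ℓ : ℝ) - 2)) ≤ (d : ℝ) ∧
  (2 ≤ ℓ → ∃ (Γ : SimpleGraph (Fin (n + 2))) (I J : Set (Fin (n + 2))),
    I.Nonempty ∧ J.Nonempty ∧ I ∪ J = Set.univ ∧ Γ.IsBipartiteWith I J ∧
    (ℓ : ℕ∞) < Γ.egirth ∧ IsEdgeDifferenceMatrix A Γ I J)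

lemma IsSensingGraph.exists_isLargeSensingMatrix {n ℓ : ℕ} {Γ : SimpleGraph (Fin (n + 2))}
    {I J : Set (Fin (n + 2))} (hΓ : IsSensingGraph ℓ Γ I J) (h2 : 2 ≤ ℓ) (hℓ : ℓ ≤ n)
    (hcard : (((n : ℝ) + 2) / 2) ^ (1 + 2 / (3 * (ℓ : ℝ) - 2)) ≤ Nat.card Γ.edgeSet) :
    ∃ A : Matrix (Fin n) (Fin (Nat.card Γ.edgeSet)) ℤ, IsLargeSensingMatrix ℓ A := by
  obtain ⟨hI, hJ, hIJ, hbip, hgirth, hedge⟩ := hΓ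
  obtain ⟨A, hA⟩ := exists_isEdgeDifferenceMatrix hbip
  have hsensing := hA.isSensingMatrix hbip.disjoint hgirth hℓ
  exact ⟨A, hsensing, hA.matrixSupNorm_eq_two hbip hedge, hsensing.injective_col h2, hcard,
    fun _ => ⟨Γ, I, J, hI, hJ, hIJ, hbip, hgirth, hA⟩⟩

lemma exists_isLargeSensingMatrix_one {n : ℕ} (hn : 2 ≤ n) :
    ∃ (d : ℕ) (A : Matrix (Fin n) (Fin d) ℤ), IsLargeSensingMatrix 1 A := by
  obtain ⟨d, A, hsensing, hnorm, hinj, hd⟩ := exists_isSensingMatrix_one hn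
  refine ⟨d, A, hsensing, hnorm, hinj, ?_, fun h => absurd h (by norm_num)⟩
  have hn' : (2 : ℝ) ≤ n := by exact_mod_cast hn
  calc (((n : ℝ) + 2) / 2) ^ (1 + 2 / (3 * ((1 : ℕ) : ℝ) - 2)) = (((n : ℝ) + 2) / 2) ^ 3 := by
        rw [← Real.rpow_natCast]
        norm_num
    _ ≤ (n : ℝ) ^ 3 := by
        gcongr
        linarith
    _ ≤ d := by exact_mod_cast hd

lemma exists_isLargeSensingMatrix {n ℓ : ℕ} (hn : 2 * 30 ^ 6 ≤ n) (h1 : 1 ≤ ℓ) (hℓ : ℓ ≤ n) :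
    ∃ (d : ℕ) (A : Matrix (Fin n) (Fin d) ℤ), IsLargeSensingMatrix ℓ A := by
  rcases h1.eq_or_lt with rfl | h2
  · exact exists_isLargeSensingMatrix_one (by omega)
  · obtain ⟨Γ, I, J, hΓ, hcard⟩ := exists_isSensingGraph hn h2
    exact ⟨_, hΓ.exists_isLargeSensingMatrix h2 hℓ hcard⟩

lemma log_div_two_le_log {x : ℝ} (hx : 0 < x) : Real.log x / 2 ≤ Real.log ((x + 2) / 2) := by
  rw [div_le_iff₀ two_pos, mul_comm, ← Nat.cast_two, ← Real.log_pow]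
  gcongr
  push_cast
  nlinarith

lemma log_rpow_div_three_le {x l ε : ℝ} (hx : 1 < x) (h1 : 1 ≤ l)
    (hl : l ≤ Real.log x ^ (1 - ε)) :
    Real.log x ^ ε / 3 ≤ Real.log ((x + 2) / 2) * (2 / (3 * l - 2)) := by
  have hlog : 0 < Real.log x := Real.log_pos hx
  have hle : Real.log x ^ ε * l ≤ Real.log x :=
    calc Real.log x ^ ε * l ≤ Real.log x ^ ε * Real.log x ^ (1 - ε) := by gcongr
      _ = Real.log x := by rw [← Real.rpow_add hlog, add_sub_cancel, Real.rpow_one]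
  have hhalf := log_div_two_le_log (zero_lt_one.trans hx)
  have hpos : 0 ≤ Real.log x ^ ε := by positivity
  rw [← mul_div_assoc, div_le_div_iff₀ three_pos (by linarith)]
  linarith

lemma exp_log_rpow_div_le {x l d ε : ℝ} (hx : 1 < x) (h1 : 1 ≤ l)
    (hl : l ≤ Real.log x ^ (1 - ε)) (hd : ((x + 2) / 2) ^ (1 + 2 / (3 * l - 2)) ≤ d) :
    Real.exp (Real.log x ^ ε / 3) / 2 ≤ d / x := by
  have hm : 0 < (x + 2) / 2 := by linarith
  rw [le_div_iff₀ (by linarith)]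
  calc Real.exp (Real.log x ^ ε / 3) / 2 * x
      = x / 2 * Real.exp (Real.log x ^ ε / 3) := by ring
    _ ≤ (x + 2) / 2 * Real.exp (Real.log ((x + 2) / 2) * (2 / (3 * l - 2))) := by
        gcongr
        · linarith
        · exact log_rpow_div_three_le hx h1 hl
    _ = ((x + 2) / 2) ^ (1 + 2 / (3 * l - 2)) := by
        rw [Real.rpow_add hm, Real.rpow_one, Real.rpow_def_of_pos hm]
    _ ≤ d := hd

lemma tendsto_exp_log_rpow_div {ε : ℝ} (hε : 0 < ε) :
    Filter.Tendsto (fun x : ℝ => Real.exp (Real.log x ^ ε / 3) / 2) Filter.atTop Filter.atTop :=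
  (Real.tendsto_exp_atTop.comp (((tendsto_rpow_atTop hε).comp
    Real.tendsto_log_atTop).atTop_div_const three_pos)).atTop_div_const two_pos

lemma log_rpow_one_sub_le {x ε : ℝ} (hx : Real.exp 1 ≤ x) (hε : 0 ≤ ε) :
    Real.log x ^ (1 - ε) ≤ x - 1 := by
  have hx0 : 0 < x := (Real.exp_pos 1).trans_le hx
  calc Real.log x ^ (1 - ε) ≤ Real.log x :=
        Real.rpow_le_self_of_one_le ((Real.le_log_iff_exp_le hx0).2 hx) (by linarith)
    _ ≤ x - 1 := Real.log_le_sub_one_of_pos hx0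

lemma tendsto_div_natCast_atTop {N : ℕ} {d : ℕ → ℕ → ℕ}
    (hd : ∀ n, N ≤ n → ∀ ℓ, 1 ≤ ℓ → ℓ ≤ n - 1 →
      (((n : ℝ) + 2) / 2) ^ (1 + 2 / (3 * (ℓ : ℝ) - 2)) ≤ (d n ℓ : ℝ))
    {ε : ℝ} (hε : 0 < ε) {ℓ : ℕ → ℕ}
    (hℓ : ∀ᶠ n : ℕ in Filter.atTop, 1 ≤ ℓ n ∧ (ℓ n : ℝ) ≤ (Real.log n) ^ (1 - ε)) :
    Filter.Tendsto (fun n : ℕ => (d n (ℓ n) : ℝ) / (n : ℝ)) Filter.atTop Filter.atTop := by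
  refine Filter.tendsto_atTop_mono' _ ?_
    ((tendsto_exp_log_rpow_div hε).comp tendsto_natCast_atTop_atTop)
  filter_upwards [hℓ, Filter.eventually_ge_atTop N,
    tendsto_natCast_atTop_atTop.eventually_ge_atTop (Real.exp 1)] with n ⟨h1, hlog⟩ hN hn
  have hn1 : (1 : ℝ) < n := (Real.one_lt_exp_iff.2 one_pos).trans_le hn
  have hle : ((ℓ n + 1 : ℕ) : ℝ) ≤ n := by
    have := hlog.trans (log_rpow_one_sub_le hn hε.le)
    push_cast
    linarith
  exact exp_log_rpow_div_le hn1 (by exact_mod_cast h1) hlog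
    (hd n hN (ℓ n) h1 (Nat.le_sub_one_of_lt (Nat.cast_le.1 hle)))

theorem mainTheorem3 :
    ∃ (N : ℕ) (d : ℕ → ℕ → ℕ) (A : (n ℓ : ℕ) → Matrix (Fin n) (Fin (d n ℓ)) ℤ),
      (∀ n : ℕ, N ≤ n → ∀ ℓ : ℕ, 1 ≤ ℓ → ℓ ≤ n - 1 →
        IsSensingMatrix ((A n ℓ).map (Int.cast : ℤ → ℝ)) ℓ ∧
        matrixSupNorm (A n ℓ) = 2 ∧
        Function.Injective (A n ℓ).col ∧
        (((n : ℝ) + 2) / 2) ^ (1 + 2 / (3 * (ℓ : ℝ) - 2)) ≤ (d n ℓ : ℝ) ∧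
        (2 ≤ ℓ → ∃ (Γ : SimpleGraph (Fin (n + 2))) (I J : Set (Fin (n + 2))),
          I.Nonempty ∧ J.Nonempty ∧ I ∪ J = Set.univ ∧ Γ.IsBipartiteWith I J ∧
          (ℓ : ℕ∞) < Γ.egirth ∧ IsEdgeDifferenceMatrix (A n ℓ) Γ I J)) ∧
      (∀ ε : ℝ, 0 < ε → ∀ ℓ : ℕ → ℕ,
        (∀ᶠ n : ℕ in Filter.atTop, 1 ≤ ℓ n ∧ (ℓ n : ℝ) ≤ (Real.log n) ^ (1 - ε)) →
        Filter.Tendsto (fun n : ℕ => (d n (ℓ n) : ℝ) / (n : ℝ)) Filter.atTop Filter.atTop) := by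
  have hexists (n ℓ : ℕ) : ∃ (d : ℕ) (A : Matrix (Fin n) (Fin d) ℤ),
      2 * 30 ^ 6 ≤ n → 1 ≤ ℓ → ℓ ≤ n - 1 → IsLargeSensingMatrix ℓ A := by
    by_cases h : 2 * 30 ^ 6 ≤ n ∧ 1 ≤ ℓ ∧ ℓ ≤ n - 1
    · obtain ⟨d, A, hA⟩ := exists_isLargeSensingMatrix h.1 h.2.1 (h.2.2.trans (n.sub_le 1))
      exact ⟨d, A, fun _ _ _ => hA⟩
    · exact ⟨0, 0, fun hn h1 hℓ => (h ⟨hn, h1, hℓ⟩).elim⟩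
  choose d A hA using hexists
  exact ⟨2 * 30 ^ 6, d, A, fun n hn ℓ h1 hℓ => hA n ℓ hn h1 hℓ, fun ε hε ℓ hℓ =>
    tendsto_div_natCast_atTop (fun n hn ℓ h1 hℓ => (hA n ℓ hn h1 hℓ).2.2.2.1) hε hℓ⟩
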